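/- Let $\mathfrak A f=-\tfrac12 f''+\tfrac12 t^2 f$. For $\theta\in[0,\pi)$ let $B_\theta$ be the operator in $L_2(\mathbb R)$ given by $B_\theta f=\mathfrak A f$ (on $\mathbb R\setminus\{0\}$) whose domain consists of all $f\in L_2(\mathbb R)$ such that $f$ and $f'$ are locally absolutely continuous on $(-\infty,0)$ and on $(0,\infty)$, $\mathfrak A f\in L_2(\mathbb R)$, $f$ is continuous at $0$, and $$\sqrt2\,\cos\theta\, f(0)=\sin\theta\,\bigl[f'(+0)-f'(-0)\bigr],$$ where $f'(\pm0)$ denote the one-sided limits of $f'$ at $0$. For $\omega\ge 0$ let $u(\cdot,\omega)$ be the (even) solution of $-\tfrac12u''+\tfrac12t^2u=-\omega^2u$ with $u(0,\omega)=1$, $u'(0,\omega)=0$, let $G(\omega)=\int_0^\infty u(s,\omega)^{-2}\,ds$ (this integral converges), and let $\alpha_B=\arctan\bigl(G(0)/\sqrt2\bigr)$. Let $\theta\in[0,\pi)$. Then: 1. $B_\theta$ has the eigenvalue $0$ if and only if $\theta=\pi-\alpha_B$. 2. $B_\theta$ has a negative eigenvalue if and only if $\theta\in(\pi-\alpha_B,\pi)$.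 3. If $\theta_1,\theta_2\in[0,\pi)$, $\lambda_j$ is an eigenvalue of $B_{\theta_j}$ for $j=1,2$, and $\lambda_2<\lambda_1<0$, then $\pi-\alpha_B<\theta_1<\theta_2<\pi$. 4. For $\theta\in(\pi-\alpha_B,\pi)$ the operator $B_\theta$ has exactly one negative eigenvalue $\Lambda(\theta)$; the function $\Lambda$ is strictly decreasing on $(\pi-\alpha_B,\pi)$, and $\Lambda(\theta)\to-\infty$ as $\theta\to\pi$ from below. -/

import Mathlib

open MeasureTheory Filter Topology Set

noncomputable section

namespace SingularOscillator

/-! ### The formal differential expression and the operators `B_θ` -/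

/-- The formal differential expression `𝔄 f = -½ f'' + ½ t² f`. -/
def formalA (f : ℝ → ℂ) (t : ℝ) : ℂ :=
  -(1 / 2 : ℂ) * deriv (deriv f) t + (1 / 2 : ℂ) * (t : ℂ) ^ 2 * f t

/-- `f` is absolutely continuous on every compact interval contained in `s`. -/
def LocallyAC (f : ℝ → ℂ) (s : Set ℝ) : Prop :=
  ∀ a b : ℝ, uIcc a b ⊆ s → AbsolutelyContinuousOnInterval f a b

/-- The domain of the maximal operator of `𝔄` on an open interval `s`
(used for `s = (0, ∞)` and `s = (-∞, 0)`): `f` and `f'` are locally absolutely continuous in `s`,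
and `f` and `𝔄 f` are square integrable over `s`.  Only the values of `f` in `s` matter. -/
structure MemMaxDomain (s : Set ℝ) (f : ℝ → ℂ) : Prop where
  differentiableOn : DifferentiableOn ℝ f s
  ac : LocallyAC f s
  ac_deriv : LocallyAC (deriv f) s
  memLp : MemLp f 2 (volume.restrict s)
  memLp_formalA : MemLp (formalA f) 2 (volume.restrict s)

/-- The functions in the domain of `B_θ`: both restrictions `f₊`, `f₋` to the open half lines
belong to the domain of the maximal operator there, `f` is continuous at `0`, and
`√2 cos θ f(0) = sin θ (f'(+0) - f'(-0))`, where `f'(±0)` are the one-sided limits of `f'` at `0`. -/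
structure MemDomainB (θ : ℝ) (f : ℝ → ℂ) : Prop where
  right : MemMaxDomain (Ioi 0) f
  left : MemMaxDomain (Iio 0) f
  continuousAt_zero : ContinuousAt f 0
  boundary : ∃ dr dl : ℂ, Tendsto (deriv f) (𝓝[>] 0) (𝓝 dr) ∧ Tendsto (deriv f) (𝓝[<] 0) (𝓝 dl) ∧
    ((√2 * Real.cos θ : ℝ) : ℂ) * f 0 = ((Real.sin θ : ℝ) : ℂ) * (dr - dl)

lemma MemMaxDomain.ae_differentiableAt_deriv {s : Set ℝ} (hs : IsOpen s) {f : ℝ → ℂ}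
    (hf : MemMaxDomain s f) : ∀ᵐ t ∂(volume.restrict s), DifferentiableAt ℝ (deriv f) t := by
  rw [ae_restrict_iff' hs.measurableSet, ae_iff]
  refine measure_null_of_locally_null _ fun x hx => ?_
  simp only [mem_ofPred_eq, Classical.not_imp] at hx
  obtain ⟨ε, hε, hb⟩ := Metric.isOpen_iff.1 hs x hx.1
  have hI : uIcc (x - ε / 2) (x + ε / 2) ⊆ s := by
    refine Subset.trans ?_ hb
    rw [uIcc_of_le (by linarith), Real.ball_eq_Ioo]
    exact fun y hy => ⟨by linarith [hy.1], by linarith [hy.2]⟩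
  have h := (hf.ac_deriv _ _ hI).boundedVariationOn.ae_differentiableAt_of_mem_uIcc
  rw [ae_iff] at h
  refine ⟨_, inter_mem_nhdsWithin _ (t := uIcc (x - ε / 2) (x + ε / 2)) ?_,
    measure_mono_null ?_ h⟩
  · rw [uIcc_of_le (by linarith)]
    exact Icc_mem_nhds (by linarith) (by linarith)
  · rintro y ⟨hy1, hy2⟩
    simp only [mem_ofPred_eq, Classical.not_imp] at hy1 ⊢
    exact ⟨hy2, hy1.2⟩

lemma MemMaxDomain.deriv_add {s : Set ℝ} (hs : IsOpen s) {f g : ℝ → ℂ}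
    (hf : MemMaxDomain s f) (hg : MemMaxDomain s g) {t : ℝ} (ht : t ∈ s) :
    deriv (f + g) t = (deriv f + deriv g) t :=
  _root_.deriv_add (hf.differentiableOn.differentiableAt (hs.mem_nhds ht))
    (hg.differentiableOn.differentiableAt (hs.mem_nhds ht))

lemma MemMaxDomain.formalA_add {s : Set ℝ} (hs : IsOpen s) {f g : ℝ → ℂ}
    (hf : MemMaxDomain s f) (hg : MemMaxDomain s g) :
    formalA (f + g) =ᵐ[volume.restrict s] formalA f + formalA g := by
  filter_upwards [hf.ae_differentiableAt_deriv hs, hg.ae_differentiableAt_deriv hs,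
    ae_restrict_mem hs.measurableSet] with t h1 h2 ht
  have he : deriv (f + g) =ᶠ[𝓝 t] deriv f + deriv g :=
    Filter.eventuallyEq_of_mem (hs.mem_nhds ht) fun y hy => hf.deriv_add hs hg hy
  simp only [formalA, he.deriv_eq, _root_.deriv_add h1 h2, Pi.add_apply]
  ring

lemma LocallyAC.congr {f g : ℝ → ℂ} {s : Set ℝ} (hf : LocallyAC f s) (h : EqOn f g s) :
    LocallyAC g s := by
  intro a b hab
  have := hf a b hab
  rw [absolutelyContinuousOnInterval_iff] at this ⊢
  intro ε hε
  obtain ⟨δ, hδ, H⟩ := this ε hε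
  refine ⟨δ, hδ, fun E hE hl => ?_⟩
  convert H E hE hl using 1
  refine Finset.sum_congr rfl fun i hi => ?_
  rw [h (hab (hE.1 i hi).1), h (hab (hE.1 i hi).2)]

lemma MemMaxDomain.add {s : Set ℝ} (hs : IsOpen s) {f g : ℝ → ℂ}
    (hf : MemMaxDomain s f) (hg : MemMaxDomain s g) : MemMaxDomain s (f + g) where
  differentiableOn := hf.differentiableOn.add hg.differentiableOn
  ac a b h := (hf.ac a b h).add (hg.ac a b h)
  ac_deriv := LocallyAC.congr (f := deriv f + deriv g)
    (fun a b h => (hf.ac_deriv a b h).add (hg.ac_deriv a b h))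
    fun _ ht => (hf.deriv_add hs hg ht).symm
  memLp := hf.memLp.add hg.memLp
  memLp_formalA :=
    (hf.memLp_formalA.add hg.memLp_formalA).ae_eq (hf.formalA_add hs hg).symm

lemma deriv_const_smul_eq (c : ℂ) (f : ℝ → ℂ) : deriv (c • f) = c • deriv f := by
  funext t
  exact deriv_const_smul_field c f

lemma formalA_smul (c : ℂ) (f : ℝ → ℂ) : formalA (c • f) = c • formalA f := by
  funext t
  simp only [formalA, deriv_const_smul_eq, Pi.smul_apply, smul_eq_mul]
  ring

lemma MemMaxDomain.smul {s : Set ℝ} (c : ℂ) {f : ℝ → ℂ}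
    (hf : MemMaxDomain s f) : MemMaxDomain s (c • f) where
  differentiableOn := hf.differentiableOn.const_smul c
  ac a b h := (hf.ac a b h).const_smul c
  ac_deriv := by
    rw [deriv_const_smul_eq]
    exact fun a b h => (hf.ac_deriv a b h).const_smul c
  memLp := hf.memLp.const_smul c
  memLp_formalA := by
    rw [formalA_smul]
    exact hf.memLp_formalA.const_smul c

lemma MemDomainB.add {θ : ℝ} {f g : ℝ → ℂ} (hf : MemDomainB θ f) (hg : MemDomainB θ g) :
    MemDomainB θ (f + g) where
  right := hf.right.add isOpen_Ioi hg.right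
  left := hf.left.add isOpen_Iio hg.left
  continuousAt_zero := hf.continuousAt_zero.add hg.continuousAt_zero
  boundary := by
    obtain ⟨a, b, ha, hb, h1⟩ := hf.boundary
    obtain ⟨c, d, hc, hd, h2⟩ := hg.boundary
    refine ⟨a + c, b + d, (ha.add hc).congr' ?_, (hb.add hd).congr' ?_, ?_⟩
    · filter_upwards [self_mem_nhdsWithin] with t ht
      exact (hf.right.deriv_add isOpen_Ioi hg.right ht).symm
    · filter_upwards [self_mem_nhdsWithin] with t ht
      exact (hf.left.deriv_add isOpen_Iio hg.left ht).symm
    · rw [Pi.add_apply, mul_add, h1, h2]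
      ring

lemma MemDomainB.smul {θ : ℝ} (c : ℂ) {f : ℝ → ℂ} (hf : MemDomainB θ f) :
    MemDomainB θ (c • f) where
  right := hf.right.smul c
  left := hf.left.smul c
  continuousAt_zero := hf.continuousAt_zero.const_smul c
  boundary := by
    obtain ⟨a, b, ha, hb, h1⟩ := hf.boundary
    refine ⟨c * a, c * b, ?_, ?_, ?_⟩
    · rw [deriv_const_smul_eq]
      exact ha.const_smul c
    · rw [deriv_const_smul_eq]
      exact hb.const_smul c
    · rw [Pi.smul_apply, smul_eq_mul, mul_left_comm, h1]
      ring

lemma ae_of_ae_halfLines {p : ℝ → Prop} (h1 : ∀ᵐ t ∂(volume.restrict (Ioi (0 : ℝ))), p t)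
    (h2 : ∀ᵐ t ∂(volume.restrict (Iio (0 : ℝ))), p t) : ∀ᵐ t, p t := by
  rw [ae_restrict_iff' measurableSet_Ioi] at h1
  rw [ae_restrict_iff' measurableSet_Iio] at h2
  have h0 : ∀ᵐ t : ℝ, t ≠ 0 := by simp [ae_iff]
  filter_upwards [h0, h1, h2] with t h0 h1 h2
  rcases lt_or_gt_of_ne h0 with h | h
  exacts [h2 h, h1 h]

lemma memLp_of_halfLines {f : ℝ → ℂ} (h1 : MemLp f 2 (volume.restrict (Ioi 0)))
    (h2 : MemLp f 2 (volume.restrict (Iio 0))) : MemLp f 2 volume := by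
  have h3 : MemLp f 2 (volume.restrict (Iic 0)) := by
    rwa [← restrict_Iio_eq_restrict_Iic]
  have e1 := (memLp_indicator_iff_restrict (μ := (volume : Measure ℝ)) (p := 2) (f := f)
    (measurableSet_Ioi (a := (0 : ℝ)))).2 h1
  have e2 := (memLp_indicator_iff_restrict (μ := (volume : Measure ℝ)) (p := 2) (f := f)
    (measurableSet_Iic (a := (0 : ℝ)))).2 h3
  have := e1.add e2
  rwa [← compl_Ioi, indicator_self_add_compl] at this

lemma MemDomainB.memLp {θ : ℝ} {f : ℝ → ℂ} (hf : MemDomainB θ f) : MemLp f 2 volume :=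
  memLp_of_halfLines hf.right.memLp hf.left.memLp

lemma MemDomainB.memLp_formalA {θ : ℝ} {f : ℝ → ℂ} (hf : MemDomainB θ f) :
    MemLp (formalA f) 2 volume :=
  memLp_of_halfLines hf.right.memLp_formalA hf.left.memLp_formalA

lemma MemDomainB.formalA_add {θ : ℝ} {f g : ℝ → ℂ} (hf : MemDomainB θ f) (hg : MemDomainB θ g) :
    formalA (f + g) =ᵐ[volume] formalA f + formalA g :=
  ae_of_ae_halfLines (hf.right.formalA_add isOpen_Ioi hg.right)
    (hf.left.formalA_add isOpen_Iio hg.left)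

lemma MemDomainB.continuous {θ : ℝ} {f : ℝ → ℂ} (hf : MemDomainB θ f) : Continuous f := by
  refine continuous_iff_continuousAt.2 fun t => ?_
  rcases lt_trichotomy t 0 with h | h | h
  · exact (hf.left.differentiableOn.differentiableAt (isOpen_Iio.mem_nhds h)).continuousAt
  · exact h ▸ hf.continuousAt_zero
  · exact (hf.right.differentiableOn.differentiableAt (isOpen_Ioi.mem_nhds h)).continuousAt

lemma MemDomainB.eq_of_ae {θ : ℝ} {f g : ℝ → ℂ} (hf : MemDomainB θ f) (hg : MemDomainB θ g)
    (h : f =ᵐ[volume] g) : f = g :=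
  (hf.continuous.ae_eq_iff_eq _ hg.continuous).1 h

/-- The domain of `B_θ` as a subspace of `L²(ℝ; ℂ)`. -/
def domainB (θ : ℝ) : Submodule ℂ (Lp ℂ 2 (volume : Measure ℝ)) where
  carrier := {F | ∃ f : ℝ → ℂ, MemDomainB θ f ∧ F =ᵐ[volume] f}
  add_mem' := by
    rintro F H ⟨f, hf, hFf⟩ ⟨g, hg, hHg⟩
    exact ⟨f + g, hf.add hg, (Lp.coeFn_add F H).trans (hFf.add hHg)⟩
  zero_mem' := by
    have hd : deriv (0 : ℝ → ℂ) = 0 := by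
      funext t
      simp
    have hA : formalA 0 = 0 := by
      funext t
      simp [formalA, hd]
    have hac : ∀ s, LocallyAC 0 s := fun s a b _ =>
      (LipschitzOnWith.absolutelyContinuousOnInterval (K := 0)
        (LipschitzWith.const (0 : ℂ)).lipschitzOnWith)
    have hm : ∀ s : Set ℝ, MemMaxDomain s 0 := fun s =>
      { differentiableOn := differentiableOn_const 0
        ac := hac s
        ac_deriv := by
          rw [hd]
          exact hac s
        memLp := MemLp.zero
        memLp_formalA := by
          rw [hA]
          exact MemLp.zero }
    refine ⟨0, ⟨hm _, hm _, continuousAt_const, 0, 0, ?_, ?_, by simp⟩, Lp.coeFn_zero _ _ _⟩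
    · rw [hd]
      exact tendsto_const_nhds
    · rw [hd]
      exact tendsto_const_nhds
  smul_mem' := by
    rintro c F ⟨f, hf, hFf⟩
    exact ⟨c • f, hf.smul c, (Lp.coeFn_smul c F).trans (hFf.const_smul c)⟩

/-- The (unique) continuous representative of an element of the domain of `B_θ`. -/
def rep (θ : ℝ) (F : domainB θ) : ℝ → ℂ := F.2.choose

lemma rep_mem (θ : ℝ) (F : domainB θ) : MemDomainB θ (rep θ F) := F.2.choose_spec.1

lemma coe_ae_eq_rep (θ : ℝ) (F : domainB θ) :
    (F : Lp ℂ 2 (volume : Measure ℝ)) =ᵐ[volume] rep θ F := F.2.choose_spec.2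

lemma rep_eq {θ : ℝ} {F : domainB θ} {f : ℝ → ℂ} (hf : MemDomainB θ f)
    (h : (F : Lp ℂ 2 (volume : Measure ℝ)) =ᵐ[volume] f) : rep θ F = f :=
  (rep_mem θ F).eq_of_ae hf ((coe_ae_eq_rep θ F).symm.trans h)

/-- The operator `B_θ` in `L²(ℝ; ℂ)`: it maps `f` to `𝔄 f`, taken on the two open half lines. -/
def opB (θ : ℝ) : Lp ℂ 2 (volume : Measure ℝ) →ₗ.[ℂ] Lp ℂ 2 (volume : Measure ℝ) where
  domain := domainB θ
  toFun :=
    { toFun := fun F => (rep_mem θ F).memLp_formalA.toLp (formalA (rep θ F))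
      map_add' := by
        intro F H
        have hr : rep θ (F + H) = rep θ F + rep θ H :=
          rep_eq ((rep_mem θ F).add (rep_mem θ H))
            ((Lp.coeFn_add _ _).trans ((coe_ae_eq_rep θ F).add (coe_ae_eq_rep θ H)))
        rw [← MemLp.toLp_add, MemLp.toLp_eq_toLp_iff, hr]
        exact (rep_mem θ F).formalA_add (rep_mem θ H)
      map_smul' := by
        intro c F
        have hr : rep θ (c • F) = c • rep θ F :=
          rep_eq ((rep_mem θ F).smul c)
            ((Lp.coeFn_smul _ _).trans ((coe_ae_eq_rep θ F).const_smul c))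
        rw [RingHom.id_apply, ← MemLp.toLp_const_smul, MemLp.toLp_eq_toLp_iff, hr, formalA_smul] }

lemma opB_ae_eq {θ : ℝ} {f : ℝ → ℂ} (hf : MemDomainB θ f) (F : (opB θ).domain)
    (h : (F : Lp ℂ 2 (volume : Measure ℝ)) =ᵐ[volume] f) : opB θ F =ᵐ[volume] formalA f := by
  have := MemLp.coeFn_toLp (rep_mem θ F).memLp_formalA
  have hr : formalA (rep θ F) = formalA f := by rw [rep_eq hf h]
  exact this.trans (Filter.EventuallyEq.of_eq hr)

/-- `μ` is an eigenvalue of the (unbounded) operator `T`. -/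
def IsEigenvalue {E : Type*} [AddCommGroup E] [Module ℂ E] (T : E →ₗ.[ℂ] E) (μ : ℂ) : Prop :=
  ∃ x : T.domain, (x : E) ≠ 0 ∧ T x = μ • (x : E)

/-! ### The solution `u(·, ω)`, the function `G` and the angle `α_B` -/

/-- The Taylor coefficients at `0` of the solution of `-½ u'' + ½ t² u = -ω² u`,
`u(0) = 1`, `u'(0) = 0`, obtained by comparing coefficients. -/
def coeffU (ω : ℝ) : ℕ → ℝ
  | 0 => 1
  | 1 => 0
  | 2 => ω ^ 2
  | 3 => 0
  | n + 4 => (2 * ω ^ 2 * coeffU ω (n + 2) + coeffU ω n) / ((n + 4) * (n + 3))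

/-- The even solution `u(t, ω)` of `-½ u'' + ½ t² u = -ω² u` with `u(0) = 1`, `u'(0) = 0`
(see `solU_solves`). -/
def solU (t ω : ℝ) : ℝ := ∑' n : ℕ, coeffU ω n * t ^ n

lemma summable_coeffU (ω r : ℝ) : Summable fun n : ℕ => |coeffU ω n| * r ^ n := by
  suffices H : ∀ R : ℝ, 0 < R → ∃ M, ∀ n, |coeffU ω n| * R ^ n ≤ M by
    set R := 2 * (|r| + 1) with hR
    have hr0 := abs_nonneg r
    have hRpos : 0 < R := by positivity
    obtain ⟨M, hM⟩ := H R hRpos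
    refine Summable.of_norm_bounded (g := fun n : ℕ => M * (1 / 2 : ℝ) ^ n)
      (summable_geometric_two.mul_left M) fun n => ?_
    rw [Real.norm_eq_abs, abs_mul, abs_abs, abs_pow]
    have h1 : |r| ^ n ≤ R ^ n * (1 / 2 : ℝ) ^ n := by
      rw [← mul_pow]
      exact pow_le_pow_left₀ hr0 (by rw [hR]; linarith) n
    calc |coeffU ω n| * |r| ^ n ≤ |coeffU ω n| * (R ^ n * (1 / 2 : ℝ) ^ n) :=
          mul_le_mul_of_nonneg_left h1 (abs_nonneg _)
      _ = |coeffU ω n| * R ^ n * (1 / 2 : ℝ) ^ n := by ring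
      _ ≤ M * (1 / 2 : ℝ) ^ n := mul_le_mul_of_nonneg_right (hM n) (by positivity)
  intro R hR
  obtain ⟨N, hN⟩ := exists_nat_ge (2 * ω ^ 2 * R ^ 2 + R ^ 4)
  set c : ℕ → ℝ := fun n => |coeffU ω n| * R ^ n with hc
  have hcn : ∀ n, 0 ≤ c n := fun n => by positivity
  set M := ∑ i ∈ Finset.range (N + 4), c i with hM
  have hM0 : 0 ≤ M := Finset.sum_nonneg fun i _ => hcn i
  refine ⟨M, fun n => ?_⟩
  induction n using Nat.strong_induction_on with
  | _ n ih =>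
    by_cases hn : n < N + 4
    · exact Finset.single_le_sum (fun i _ => hcn i) (Finset.mem_range.2 hn)
    · obtain ⟨m, rfl⟩ : ∃ m, n = m + 4 := ⟨n - 4, by omega⟩
      have hNm : (N : ℝ) ≤ m := by exact_mod_cast (by omega : N ≤ m)
      have hm0 : (0 : ℝ) ≤ m := Nat.cast_nonneg m
      have i1 : c (m + 2) ≤ M := ih (m + 2) (by omega)
      have i2 : c m ≤ M := ih m (by omega)
      have hden : (0 : ℝ) < ((m : ℝ) + 4) * (m + 3) := by positivity
      have e : |coeffU ω (m + 4)| * R ^ (m + 4) =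
          |2 * ω ^ 2 * coeffU ω (m + 2) + coeffU ω m| * R ^ (m + 4) / (((m : ℝ) + 4) * (m + 3)) := by
        rw [coeffU, abs_div, abs_of_pos hden]
        ring
      rw [e, div_le_iff₀ hden]
      have h3 : |2 * ω ^ 2 * coeffU ω (m + 2) + coeffU ω m| ≤
          2 * ω ^ 2 * |coeffU ω (m + 2)| + |coeffU ω m| := by
        refine (abs_add_le _ _).trans ?_
        rw [abs_mul, abs_of_nonneg (by positivity : (0 : ℝ) ≤ 2 * ω ^ 2)]
      calc |2 * ω ^ 2 * coeffU ω (m + 2) + coeffU ω m| * R ^ (m + 4)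
          ≤ (2 * ω ^ 2 * |coeffU ω (m + 2)| + |coeffU ω m|) * R ^ (m + 4) :=
            mul_le_mul_of_nonneg_right h3 (by positivity)
        _ = 2 * ω ^ 2 * R ^ 2 * c (m + 2) + R ^ 4 * c m := by
            simp only [hc]
            ring
        _ ≤ 2 * ω ^ 2 * R ^ 2 * M + R ^ 4 * M := by gcongr
        _ = (2 * ω ^ 2 * R ^ 2 + R ^ 4) * M := by ring
        _ ≤ (((m : ℝ) + 4) * (m + 3)) * M := by
            refine mul_le_mul_of_nonneg_right ?_ hM0
            nlinarith
        _ = M * (((m : ℝ) + 4) * (m + 3)) := by ring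

lemma hasDerivAt_entire {a : ℕ → ℝ} (ha : ∀ r : ℝ, Summable fun n : ℕ => |a n| * r ^ n) :
    (∀ r : ℝ, Summable fun n : ℕ => |(n + 1) * a (n + 1)| * r ^ n) ∧
    ∀ t : ℝ, HasDerivAt (fun t => ∑' n, a n * t ^ n) (∑' n, (n + 1) * a (n + 1) * t ^ n) t := by
  have key : ∀ r : ℝ, 1 ≤ r → Summable fun n : ℕ => |a n| * (n * r ^ (n - 1)) := by
    intro r hr
    refine Summable.of_nonneg_of_le (fun n => by positivity) (fun n => ?_) (ha (2 * r))
    have h1 : (n : ℝ) ≤ 2 ^ n := by exact_mod_cast Nat.lt_two_pow_self.le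
    have h2 : r ^ (n - 1) ≤ r ^ n := pow_le_pow_right₀ hr (Nat.sub_le n 1)
    rw [mul_pow]
    gcongr
  have shift : ∀ r : ℝ, Summable fun n : ℕ => |(n + 1) * a (n + 1)| * r ^ n := by
    intro r
    have h := (summable_nat_add_iff 1).2 (key (|r| + 1) (by linarith [abs_nonneg r]))
    refine Summable.of_norm_bounded h fun n => ?_
    have hn : |(n : ℝ) + 1| = n + 1 := abs_of_nonneg (by positivity)
    rw [Real.norm_eq_abs, abs_mul, abs_abs, abs_mul, abs_pow, hn]
    have h1 : |r| ^ n ≤ (|r| + 1) ^ n := pow_le_pow_left₀ (abs_nonneg r) (by linarith) n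
    have h2 : |r| ^ n * ((n + 1) * |a (n + 1)|) ≤ (|r| + 1) ^ n * ((n + 1) * |a (n + 1)|) :=
      mul_le_mul_of_nonneg_right h1 (by positivity)
    rw [Nat.add_sub_cancel]
    push_cast
    linarith
  refine ⟨shift, fun t => ?_⟩
  have hd : HasDerivAt (fun t => ∑' n, a n * t ^ n)
      (∑' n : ℕ, a n * (n * t ^ (n - 1))) t := by
    refine hasDerivAt_tsum_of_isPreconnected (key (|t| + 1) (by linarith [abs_nonneg t]))
      (t := Metric.ball 0 (|t| + 1)) (y₀ := 0) Metric.isOpen_ball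
      (convex_ball _ _).isPreconnected (g := fun n t => a n * t ^ n)
      (g' := fun n t => a n * (n * t ^ (n - 1)))
      (fun n y _ => (hasDerivAt_pow n y).const_mul _) (fun n y hy => ?_) (by simp; positivity) ?_ ?_
    · rw [mem_ball_zero_iff, Real.norm_eq_abs] at hy
      rw [Real.norm_eq_abs, abs_mul, abs_mul, abs_pow, Nat.abs_cast]
      gcongr
    · refine summable_of_ne_finset_zero (s := {0}) fun n hn => ?_
      simp only [Finset.mem_singleton] at hn
      simp [hn]
    · rw [mem_ball_zero_iff, Real.norm_eq_abs]
      linarith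
  have hs : Summable fun n : ℕ => a n * (n * t ^ (n - 1)) := by
    rw [← summable_nat_add_iff 1]
    refine Summable.of_norm_bounded (shift |t|) fun n => le_of_eq ?_
    rw [Real.norm_eq_abs, abs_mul, abs_mul, abs_mul, abs_pow, Nat.add_sub_cancel]
    push_cast
    ring
  convert hd using 1
  rw [hs.tsum_eq_zero_add]
  simp only [Nat.cast_zero, zero_mul, mul_zero, zero_add, Nat.add_sub_cancel, Nat.cast_add,
    Nat.cast_one]
  exact tsum_congr fun n => by ring

/-- `u(·, ω)` solves the Cauchy problem that characterises it. -/
lemma solU_solves (ω : ℝ) :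
    solU 0 ω = 1 ∧ deriv (fun t => solU t ω) 0 = 0 ∧
    Differentiable ℝ (fun t => solU t ω) ∧ Differentiable ℝ (deriv fun t => solU t ω) ∧
    ∀ t, -(1 / 2) * deriv (deriv fun t => solU t ω) t + (1 / 2) * t ^ 2 * solU t ω
      = -ω ^ 2 * solU t ω := by
  have h0 := summable_coeffU ω
  obtain ⟨s1, d1⟩ := hasDerivAt_entire h0
  obtain ⟨s2, d2⟩ := hasDerivAt_entire (a := fun n : ℕ => (n + 1) * coeffU ω (n + 1)) s1
  have e1 : (deriv fun t => solU t ω) = fun t => ∑' n : ℕ, (n + 1) * coeffU ω (n + 1) * t ^ n :=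
    funext fun t => (d1 t).deriv
  have z : ∀ b : ℕ → ℝ, ∑' n, b n * (0 : ℝ) ^ n = b 0 := fun b => by
    rw [tsum_eq_single 0 fun n hn => by simp [hn]]
    simp
  have abs_summable : ∀ (b : ℕ → ℝ) (t : ℝ), (∀ r : ℝ, Summable fun n : ℕ => |b n| * r ^ n) →
      Summable fun n => b n * t ^ n := fun b t hb =>
    Summable.of_norm_bounded (hb |t|) fun n => by
      rw [Real.norm_eq_abs, abs_mul, abs_pow]
  refine ⟨by rw [solU, z, coeffU], ?_, fun t => (d1 t).differentiableAt, ?_, fun t => ?_⟩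
  · rw [e1]
    simp only [z, coeffU]
    simp
  · rw [e1]
    exact fun t => (d2 t).differentiableAt
  · have hU := abs_summable _ t h0
    have hW := abs_summable _ t s2
    rw [e1, (d2 t).deriv]
    have hU2 : solU t ω = 1 + ∑' n : ℕ, coeffU ω (n + 2) * t ^ (n + 2) := by
      rw [solU, ← hU.sum_add_tsum_nat_add 2]
      simp [Finset.sum_range_succ, coeffU]
    have hS0 : Summable fun n : ℕ => coeffU ω n * t ^ (n + 2) :=
      (hU.mul_right (t ^ 2)).congr fun n => by ring
    have hS2 : Summable fun n : ℕ => coeffU ω (n + 2) * t ^ (n + 2) :=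
      (summable_nat_add_iff (f := fun n => coeffU ω n * t ^ n) 2).2 hU
    have ht : t ^ 2 * solU t ω = ∑' n : ℕ, coeffU ω n * t ^ (n + 2) := by
      rw [solU, ← tsum_mul_left]
      exact tsum_congr fun n => by ring
    have hW2 : ∑' n : ℕ, ((n : ℝ) + 1) * ((((n + 1 : ℕ) : ℝ) + 1) * coeffU ω (n + 1 + 1)) * t ^ n
        = 2 * ω ^ 2 * solU t ω + t ^ 2 * solU t ω := by
      rw [← hW.sum_add_tsum_nat_add 2, hU2, mul_add, ← hU2, ht, ← tsum_mul_left, add_assoc,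
        ← (hS2.mul_left _).tsum_add hS0]
      simp only [Finset.sum_range_succ, Finset.sum_range_zero, coeffU]
      congr 1
      · norm_num
      · refine tsum_congr fun n => ?_
        have : ((n : ℝ) + 4) * (n + 3) ≠ 0 := by positivity
        push_cast
        field_simp
        ring
    rw [hW2]
    ring

/-- `G(ω) = ∫₀^∞ u(s, ω)⁻² ds`. -/
def G (ω : ℝ) : ℝ := ∫ s in Ioi (0 : ℝ), (solU s ω ^ 2)⁻¹

/-- `α_B = arctan (G(0) / √2)`. -/
def alphaB : ℝ := Real.arctan (G 0 / √2)

end SingularOscillator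

end

namespace SingularOscillator

/-! ### The even solution -/

/-! Fix `ω` and write `u` for `solU · ω`. Since `u ≥ 1`, reduction of order describes every solution
of `𝔄 f = -ω² f` on `(0, ∞)`: the Wronskian with `u` is a constant, equal to `f'(+0)`, and `f(t) =
u(t) (f(0) + f'(+0) ∫₀ᵗ u⁻²)`. Square integrability forces the bracket to vanish at infinity, so
`f(0) + G(ω) f'(+0) = 0` (`eq_neg_G_smul_of_memLp`). As `u` is even, reflection gives `f(0) - G(ω)
f'(-0) = 0`. Hence the jump of `f'` is `-2 f(0) / G(ω)`, with `f(0) ≠ 0` unless `f = 0`, and the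
boundary condition becomes `G(ω) cos θ = -√2 sin θ` (`cos_sin_of_eigenfunction`). Conversely, `u(t)
(G(ω) - ∫₀^|t| u⁻²)` is an eigenfunction for such `θ` (`exists_eigenfunction`).

On `[0, π)` this equation says `θ = π - arctan (G(ω) / √2)` (`isEigenvalue_opB_iff`). The Taylor
coefficients of `u` are nonnegative and nondecreasing in `|ω|`, which makes `G` continuous and
strictly decreasing on `[0, ∞)` with limit `0`. So `angle` maps `[0, ∞)` bijectively and
increasingly onto `[π - α_B, π)`, and all four claims are read off from its inverse. -/

lemma coeffU_nonneg (ω : ℝ) (n : ℕ) : 0 ≤ coeffU ω n := by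
  induction n using Nat.strong_induction_on with
  | _ n ih =>
    match n, ih with
    | 0, _ => simp [coeffU]
    | 1, _ => simp [coeffU]
    | 2, _ => simp only [coeffU]; positivity
    | 3, _ => simp [coeffU]
    | n + 4, ih =>
      have h1 := ih n (by omega)
      have h2 := ih (n + 2) (by omega)
      rw [coeffU]
      positivity

lemma coeffU_le {ω ω' : ℝ} (h : |ω| ≤ |ω'|) (n : ℕ) : coeffU ω n ≤ coeffU ω' n := by
  have hsq : ω ^ 2 ≤ ω' ^ 2 := sq_le_sq.2 h
  induction n using Nat.strong_induction_on with
  | _ n ih =>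
    match n, ih with
    | 0, _ => simp [coeffU]
    | 1, _ => simp [coeffU]
    | 2, _ => simpa only [coeffU] using hsq
    | 3, _ => simp [coeffU]
    | n + 4, ih =>
      have h1 := ih n (by omega)
      have h2 := ih (n + 2) (by omega)
      have h3 := coeffU_nonneg ω (n + 2)
      rw [coeffU, coeffU]
      gcongr

lemma coeffU_odd (ω : ℝ) {n : ℕ} (hn : Odd n) : coeffU ω n = 0 := by
  induction n using Nat.strong_induction_on with
  | _ n ih =>
    match n, hn, ih with
    | 0, hn, _ => simp at hn
    | 1, _, _ => simp [coeffU]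
    | 2, hn, _ => exact absurd hn (by decide)
    | 3, _, _ => simp [coeffU]
    | n + 4, hn, ih =>
      have h1 := ih n (by omega) (by grind)
      have h2 := ih (n + 2) (by omega) (by grind)
      rw [coeffU, h1, h2]
      simp

/-- Only even powers survive, so the terms are nonnegative for negative `t` too, and partial sums
are lower bounds for `solU`. -/
lemma coeffU_mul_pow_nonneg (ω t : ℝ) (n : ℕ) : 0 ≤ coeffU ω n * t ^ n := by
  rcases Nat.even_or_odd n with h | h
  · exact mul_nonneg (coeffU_nonneg ω n) (h.pow_nonneg t)
  · simp [coeffU_odd ω h]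

lemma summable_solU (ω t : ℝ) : Summable fun n : ℕ => coeffU ω n * t ^ n :=
  Summable.of_norm_bounded (summable_coeffU ω |t|) fun n => by
    rw [Real.norm_eq_abs, abs_mul, abs_pow]

lemma solU_neg (t ω : ℝ) : solU (-t) ω = solU t ω := by
  refine tsum_congr fun n => ?_
  rcases Nat.even_or_odd n with h | h
  · rw [h.neg_pow]
  · simp [coeffU_odd ω h]

/-- These are the terms of degree at most 4, with the `ω⁴` part of the last one dropped. The quartic
term gives decay of `1 / u` uniformly in `ω`; the quadratic one makes `G` tend to `0`. -/
lemma le_solU (t ω : ℝ) : 1 + ω ^ 2 * t ^ 2 + t ^ 4 / 12 ≤ solU t ω := by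
  have h := (summable_solU ω t).sum_le_tsum (Finset.range 5)
    fun n _ => coeffU_mul_pow_nonneg ω t n
  refine le_trans ?_ h
  simp only [Finset.sum_range_succ, Finset.sum_range_zero, coeffU]
  have : 0 ≤ ω ^ 2 * ω ^ 2 * t ^ 4 := by positivity
  norm_num
  nlinarith

lemma one_le_solU (t ω : ℝ) : 1 ≤ solU t ω := by
  have := le_solU t ω
  have h1 : 0 ≤ ω ^ 2 * t ^ 2 := by positivity
  have h2 : 0 ≤ t ^ 4 := by positivity
  linarith

lemma solU_pos (t ω : ℝ) : 0 < solU t ω := zero_lt_one.trans_le (one_le_solU t ω)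

lemma solU_lt {ω ω' t : ℝ} (h : |ω| < |ω'|) (ht : t ≠ 0) : solU t ω < solU t ω' := by
  -- Strictness comes from the coefficient `ω²` of `t²`.
  refine Summable.tsum_lt_tsum (i := 2) (fun n => ?_) ?_ (summable_solU ω t) (summable_solU ω' t)
  · rcases Nat.even_or_odd n with hn | hn
    · exact mul_le_mul_of_nonneg_right (coeffU_le h.le n) (hn.pow_nonneg t)
    · simp [coeffU_odd _ hn]
  · simp only [coeffU]
    exact mul_lt_mul_of_pos_right (sq_lt_sq.2 h) (by positivity)

lemma continuous_solU_right (t : ℝ) : Continuous fun ω => solU t ω := by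
  have hc : ∀ n, Continuous fun ω => coeffU ω n := by
    intro n
    induction n using Nat.strong_induction_on with
    | _ n ih =>
      match n, ih with
      | 0, _ => simpa only [coeffU] using continuous_const
      | 1, _ => simpa only [coeffU] using continuous_const
      | 2, _ => simpa only [coeffU] using continuous_pow 2
      | 3, _ => simpa only [coeffU] using continuous_const
      | n + 4, ih =>
        have h1 := ih n (by omega)
        have h2 := ih (n + 2) (by omega)
        simp only [coeffU]
        fun_prop
  refine continuous_iff_continuousAt.2 fun ω₀ => ?_
  -- Weierstrass test: by monotonicity in `|ω|`, the coefficients at `|ω₀| + 1` dominate those on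
  -- the whole ball.
  have : ContinuousOn (fun ω => solU t ω) (Metric.ball 0 (|ω₀| + 1)) := by
    refine continuousOn_tsum (fun n => ((hc n).mul continuous_const).continuousOn)
      (summable_coeffU (|ω₀| + 1) |t|) fun n ω hω => ?_
    rw [mem_ball_zero_iff, Real.norm_eq_abs] at hω
    rw [Real.norm_eq_abs, abs_mul, abs_pow, abs_of_nonneg (coeffU_nonneg _ _),
      abs_of_nonneg (coeffU_nonneg _ _)]
    refine mul_le_mul_of_nonneg_right (coeffU_le (hω.le.trans (le_abs_self _)) n) (by positivity)
  exact this.continuousAt (Metric.isOpen_ball.mem_nhds (by simp))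

/-- The derivative of `u(·, ω)`. -/
noncomputable def solUDeriv (t ω : ℝ) : ℝ := deriv (fun s => solU s ω) t

lemma solU_zero (ω : ℝ) : solU 0 ω = 1 := (solU_solves ω).1

lemma solUDeriv_zero (ω : ℝ) : solUDeriv 0 ω = 0 := (solU_solves ω).2.1

lemma hasDerivAt_solU (t ω : ℝ) : HasDerivAt (fun s => solU s ω) (solUDeriv t ω) t :=
  ((solU_solves ω).2.2.1 t).hasDerivAt

lemma hasDerivAt_solUDeriv (t ω : ℝ) :
    HasDerivAt (fun s => solUDeriv s ω) ((t ^ 2 + 2 * ω ^ 2) * solU t ω) t := by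
  obtain ⟨-, -, -, hd, ho⟩ := solU_solves ω
  have h := (hd t).hasDerivAt
  have e : deriv (deriv fun s => solU s ω) t = (t ^ 2 + 2 * ω ^ 2) * solU t ω := by
    linarith [ho t]
  rwa [e] at h

lemma solUDeriv_neg (t ω : ℝ) : solUDeriv (-t) ω = -solUDeriv t ω := by
  have h := (hasDerivAt_solU (-t) ω).scomp t (hasDerivAt_neg t)
  have e : (fun s => solU s ω) ∘ (fun s => -s) = fun s => solU s ω := by
    funext s
    exact solU_neg s ω
  have := h.unique (e ▸ hasDerivAt_solU t ω)
  simp at this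
  linarith

lemma continuous_solU (ω : ℝ) : Continuous fun t => solU t ω :=
  continuous_iff_continuousAt.2 fun t => (hasDerivAt_solU t ω).continuousAt

lemma continuous_solUDeriv (ω : ℝ) : Continuous fun t => solUDeriv t ω :=
  continuous_iff_continuousAt.2 fun t => (hasDerivAt_solUDeriv t ω).continuousAt

lemma monotoneOn_solU (ω : ℝ) : MonotoneOn (fun t => solU t ω) (Ici 0) := by
  intro s hs t _ hst
  refine (summable_solU ω s).tsum_le_tsum (fun n => ?_) (summable_solU ω t)
  exact mul_le_mul_of_nonneg_left (pow_le_pow_left₀ hs hst n) (coeffU_nonneg ω n)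

lemma contDiff_one_of_hasDerivAt {f f' : ℝ → ℝ} (h : ∀ t, HasDerivAt f (f' t) t)
    (hc : Continuous f') : ContDiff ℝ 1 f :=
  contDiff_one_iff_deriv.2 ⟨fun t => (h t).differentiableAt, by
    rwa [show deriv f = f' from funext fun t => (h t).deriv]⟩

lemma contDiff_solU (ω : ℝ) : ContDiff ℝ 1 fun t => solU t ω :=
  contDiff_one_of_hasDerivAt (fun t => hasDerivAt_solU t ω) (continuous_solUDeriv ω)

lemma contDiff_solUDeriv (ω : ℝ) : ContDiff ℝ 1 fun t => solUDeriv t ω :=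
  contDiff_one_of_hasDerivAt (fun t => hasDerivAt_solUDeriv t ω)
    (by have := continuous_solU ω; fun_prop)

/-! ### The function `G` -/

/-- The constant comes from `(1 + t²)² ≤ 2 + 2 t⁴ ≤ 24 (1 + t⁴ / 12)`. It does not depend on `ω`, so
the bound also serves as a dominating function in `continuous_G`. -/
lemma inv_solU_le (t ω : ℝ) : (solU t ω)⁻¹ ≤ 24 * ((1 + t ^ 2) ^ 2)⁻¹ := by
  have h := le_solU t ω
  have h1 : 0 ≤ ω ^ 2 * t ^ 2 := by positivity
  have hp := solU_pos t ω
  rw [inv_le_iff_one_le_mul₀ hp, mul_assoc, inv_mul_eq_div, ← mul_div_assoc,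
    one_le_div (by positivity)]
  nlinarith [sq_nonneg (t ^ 2 - 1)]

lemma inv_sq_solU_le_inv (t ω : ℝ) : (solU t ω ^ 2)⁻¹ ≤ (solU t ω)⁻¹ := by
  have h := one_le_solU t ω
  have := solU_pos t ω
  gcongr
  nlinarith

lemma inv_sq_solU_le (t ω : ℝ) : (solU t ω ^ 2)⁻¹ ≤ 24 * (1 + t ^ 2)⁻¹ := by
  refine (inv_sq_solU_le_inv t ω).trans ((inv_solU_le t ω).trans ?_)
  gcongr
  nlinarith [sq_nonneg t]

lemma continuous_inv_sq_solU (ω : ℝ) : Continuous fun t => (solU t ω ^ 2)⁻¹ :=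
  ((continuous_solU ω).pow 2).inv₀ fun t => (pow_pos (solU_pos t ω) 2).ne'

lemma integrable_inv_sq_solU (ω : ℝ) : Integrable fun t => (solU t ω ^ 2)⁻¹ := by
  refine (integrable_inv_one_add_sq.const_mul 24).mono'
    (continuous_inv_sq_solU ω).aestronglyMeasurable (ae_of_all _ fun t => ?_)
  rw [Real.norm_of_nonneg (by positivity)]
  exact inv_sq_solU_le t ω

lemma G_lt {ω ω' : ℝ} (h : |ω| < |ω'|) : G ω' < G ω := by
  rw [← sub_pos, G, G, ← integral_sub (integrable_inv_sq_solU ω).integrableOn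
    (integrable_inv_sq_solU ω').integrableOn]
  have hlt : ∀ t ∈ Ioi (0 : ℝ), 0 < (solU t ω ^ 2)⁻¹ - (solU t ω' ^ 2)⁻¹ := fun t ht => by
    have h1 := solU_lt h (ne_of_gt ht)
    have h2 := solU_pos t ω
    rw [sub_pos]
    gcongr
  rw [setIntegral_pos_iff_support_of_nonneg_ae
    ((ae_restrict_mem measurableSet_Ioi).mono fun t ht => (hlt t ht).le)
    ((integrable_inv_sq_solU ω).sub (integrable_inv_sq_solU ω')).integrableOn]
  have hsub : Ioi (0 : ℝ) ⊆ Function.support fun t => (solU t ω ^ 2)⁻¹ - (solU t ω' ^ 2)⁻¹ :=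
    fun t ht => (hlt t ht).ne'
  rw [inter_eq_right.2 hsub, Real.volume_Ioi]
  simp

lemma G_strictAntiOn : StrictAntiOn G (Ici 0) := fun a ha b hb hab =>
  G_lt (by rwa [abs_of_nonneg ha, abs_of_nonneg hb])

lemma G_nonneg (ω : ℝ) : 0 ≤ G ω :=
  integral_nonneg fun _ => inv_nonneg.2 (sq_nonneg _)

/-- Strict monotonicity upgrades nonnegativity: `G ω` exceeds `G (|ω| + 1) ≥ 0`. -/
lemma G_pos (ω : ℝ) : 0 < G ω :=
  (G_nonneg (|ω| + 1)).trans_lt (G_lt (by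
    rw [abs_of_nonneg (by positivity : 0 ≤ |ω| + 1)]
    linarith))

lemma continuous_G : Continuous G := by
  refine continuous_of_dominated (fun ω => (continuous_inv_sq_solU ω).aestronglyMeasurable)
    (bound := fun t => 24 * (1 + t ^ 2)⁻¹) (fun ω => ae_of_all _ fun t => ?_)
    (integrable_inv_one_add_sq.const_mul 24).integrableOn (ae_of_all _ fun t => ?_)
  · rw [Real.norm_of_nonneg (by positivity)]
    exact inv_sq_solU_le t ω
  · exact ((continuous_solU_right t).pow 2).inv₀ fun ω => (pow_pos (solU_pos t ω) 2).ne'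

/-- Since `u⁻² ≤ u⁻¹ ≤ (1 + (ω t)²)⁻¹`, a rescaled arctangent integral bounds `G`. -/
lemma G_le {ω : ℝ} (hω : 0 < ω) : G ω ≤ ω⁻¹ * (Real.pi / 2) := by
  have e := integral_comp_mul_left_Ioi (fun x : ℝ => (1 + x ^ 2)⁻¹) 0 hω
  rw [mul_zero, integral_Ioi_inv_one_add_sq, Real.arctan_zero, sub_zero, smul_eq_mul] at e
  rw [← e]
  refine setIntegral_mono_on (integrable_inv_sq_solU ω).integrableOn
    (integrable_inv_one_add_sq.comp_mul_left' hω.ne').integrableOn measurableSet_Ioi fun t _ => ?_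
  refine (inv_sq_solU_le_inv t ω).trans ?_
  have h := le_solU t ω
  have h2 : 0 ≤ t ^ 4 := by positivity
  gcongr
  nlinarith

lemma tendsto_G : Tendsto G atTop (𝓝 0) := by
  have h : Tendsto (fun ω : ℝ => ω⁻¹ * (Real.pi / 2)) atTop (𝓝 0) := by
    simpa using tendsto_inv_atTop_zero.mul_const (Real.pi / 2)
  refine tendsto_of_tendsto_of_tendsto_of_le_of_le' tendsto_const_nhds h
    (Eventually.of_forall G_nonneg) ?_
  filter_upwards [eventually_gt_atTop 0] with ω hω using G_le hω

end SingularOscillator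

namespace SingularOscillator

/-! ### Square integrable solutions on a half line -/

/-- The Wronskian of `u(·, ω)` and of a solution of `𝔄 f = -ω² f` is constant. -/
lemma wronskian_const {s : Set ℝ} (hs : IsOpen s) (hc : s.OrdConnected) {f : ℝ → ℂ}
    (hf : MemMaxDomain s f) {ω : ℝ}
    (heq : ∀ᵐ t ∂(volume.restrict s), formalA f t = ((-ω ^ 2 : ℝ) : ℂ) * f t) :
    ∃ d : ℂ, ∀ t ∈ s, solU t ω • deriv f t - solUDeriv t ω • f t = d := by
  rcases s.eq_empty_or_nonempty with rfl | ⟨a, ha⟩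
  · exact ⟨0, by simp⟩
  refine ⟨solU a ω • deriv f a - solUDeriv a ω • f a, fun b hb => ?_⟩
  have hI : uIcc a b ⊆ s := hc.uIcc_subset ha hb
  have hac : AbsolutelyContinuousOnInterval
      (fun t => solU t ω • deriv f t - solUDeriv t ω • f t) a b :=
    ((contDiff_solU ω).contDiffOn.absolutelyContinuousOnInterval.fun_smul
      (hf.ac_deriv a b hI)).fun_sub
      ((contDiff_solUDeriv ω).contDiffOn.absolutelyContinuousOnInterval.fun_smul (hf.ac a b hI))
  -- The second derivative of `f` exists only almost everywhere, so a zero derivative alone would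
  -- not give constancy; absolute continuity of the Wronskian closes the gap.
  have hd : ∀ᵐ t, t ∈ uIcc a b →
      HasDerivAt (fun t => solU t ω • deriv f t - solUDeriv t ω • f t) 0 t := by
    have h1 := (ae_restrict_iff' hs.measurableSet).1 (hf.ae_differentiableAt_deriv hs)
    have h2 := (ae_restrict_iff' hs.measurableSet).1 heq
    filter_upwards [h1, h2] with t h1 h2 ht
    have hts := hI ht
    have hfd := (hf.differentiableOn.differentiableAt (hs.mem_nhds hts)).hasDerivAt
    have key := ((hasDerivAt_solU t ω).smul (h1 hts).hasDerivAt).sub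
      ((hasDerivAt_solUDeriv t ω).smul hfd)
    refine key.congr_deriv ?_
    have h3 := h2 hts
    rw [formalA] at h3
    have e : deriv (deriv f) t = ((t : ℂ) ^ 2 + 2 * (ω : ℂ) ^ 2) * f t := by
      push_cast at h3
      linear_combination -2 * h3
    rw [e]
    simp only [Complex.real_smul]
    push_cast
    ring
  obtain ⟨C, hC⟩ := hac.const_of_ae_hasDerivAt_zero hd
  exact (hC b right_mem_uIcc).trans (hC a left_mem_uIcc).symm

/-- The primitive `∫₀^t u(s, ω)⁻² ds`. -/
noncomputable def primG (ω t : ℝ) : ℝ := ∫ s in (0 : ℝ)..t, (solU s ω ^ 2)⁻¹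

lemma hasDerivAt_primG (ω t : ℝ) : HasDerivAt (primG ω) (solU t ω ^ 2)⁻¹ t :=
  intervalIntegral.integral_hasDerivAt_right
    ((continuous_inv_sq_solU ω).intervalIntegrable _ _)
    (continuous_inv_sq_solU ω).aestronglyMeasurable.stronglyMeasurableAtFilter
    (continuous_inv_sq_solU ω).continuousAt

lemma primG_zero (ω : ℝ) : primG ω 0 = 0 := intervalIntegral.integral_same

lemma primG_neg (ω t : ℝ) : primG ω (-t) = -primG ω t := by
  have h := intervalIntegral.integral_comp_neg (a := 0) (b := t) fun s => (solU s ω ^ 2)⁻¹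
  simp only [solU_neg, neg_zero] at h
  rw [primG, primG, h, intervalIntegral.integral_symm]

lemma tendsto_primG (ω : ℝ) : Tendsto (primG ω) atTop (𝓝 (G ω)) :=
  intervalIntegral_tendsto_integral_Ioi 0 (integrable_inv_sq_solU ω).integrableOn tendsto_id

lemma G_sub_primG (ω : ℝ) {t : ℝ} (ht : 0 ≤ t) :
    G ω - primG ω t = ∫ s in Ioi t, (solU s ω ^ 2)⁻¹ := by
  rw [primG, G, ← intervalIntegral.integral_Ioi_sub_Ioi
    (integrable_inv_sq_solU ω).integrableOn ht]
  ring

/-- A function on the positive half line which stays away from zero near infinity is not square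
integrable. -/
lemma not_memLp_of_eventually_le {f : ℝ → ℂ} {c : ℝ} (hc : 0 < c)
    (h : ∀ᶠ t in atTop, c ≤ ‖f t‖) : ¬ MemLp f 2 (volume.restrict (Ioi 0)) := by
  intro hf
  obtain ⟨T, hT⟩ := eventually_atTop.1 h
  -- By Chebyshev the set where `c ≤ ‖f‖` has finite measure, yet it contains a ray.
  have h1 := hf.meas_ge_lt_top (ε := ⟨c, hc.le⟩) two_ne_zero (by simp)
    (fun h => hc.ne' (congrArg NNReal.toReal h))
  have h2 : Ioi (max T 0) ⊆ {x | (⟨c, hc.le⟩ : NNReal) ≤ ‖f x‖₊} := fun t ht =>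
    hT t ((le_max_left _ _).trans ht.le)
  have h3 : (volume.restrict (Ioi (0 : ℝ))) (Ioi (max T 0)) = ⊤ := by
    rw [Measure.restrict_apply measurableSet_Ioi,
      inter_eq_left.2 (Ioi_subset_Ioi (le_max_right T 0)), Real.volume_Ioi]
  exact (h3 ▸ (measure_mono h2).trans_lt h1).ne rfl

/-- Reduction of order: `(f / u)' = d / u²`. The derivative is a separate argument `f'` so that the
lemma also applies to reflected functions. -/
lemma eq_of_wronskian_const {f f' : ℝ → ℂ} {ω : ℝ} {c d : ℂ}
    (hd : ∀ t > 0, HasDerivAt f (f' t) t)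
    (hw : ∀ t > 0, solU t ω • f' t - solUDeriv t ω • f t = d)
    (h0 : Tendsto f (𝓝[>] 0) (𝓝 c)) {t : ℝ} (ht : 0 < t) :
    f t = solU t ω • (c + primG ω t • d) := by
  set q : ℝ → ℂ := fun t => (solU t ω)⁻¹ • f t - primG ω t • d with hq
  have hqd : ∀ t ∈ Ioi (0 : ℝ), HasDerivAt q 0 t := fun t ht => by
    have hu := (solU_pos t ω).ne'
    have key := (((hasDerivAt_solU t ω).inv hu).smul (hd t ht)).sub
      ((hasDerivAt_primG ω t).smul_const d)
    refine key.congr_deriv ?_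
    rw [← hw t ht]
    simp only [Complex.real_smul, Pi.inv_apply]
    have : (solU t ω : ℂ) ≠ 0 := by exact_mod_cast hu
    push_cast
    field_simp
    ring
  have hconst : ∀ s ∈ Ioi (0 : ℝ), q s = q t := fun s hs =>
    isOpen_Ioi.is_const_of_deriv_eq_zero isPreconnected_Ioi
      (fun x hx => (hqd x hx).differentiableAt.differentiableWithinAt)
      (fun x hx => (hqd x hx).deriv) hs ht
  have hlim : Tendsto q (𝓝[>] 0) (𝓝 c) := by
    have hu : Tendsto (fun t => solU t ω) (𝓝[>] 0) (𝓝 1) := by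
      simpa [solU_zero] using ((continuous_solU ω).tendsto 0).mono_left nhdsWithin_le_nhds
    have hp : Tendsto (primG ω) (𝓝[>] 0) (𝓝 0) := by
      simpa [primG_zero] using
        (hasDerivAt_primG ω 0).continuousAt.tendsto.mono_left nhdsWithin_le_nhds
    simpa [hq] using ((hu.inv₀ one_ne_zero).smul h0).sub (hp.smul_const d)
  have hqc : q t = c := tendsto_nhds_unique
    (tendsto_const_nhds.congr' (by
      filter_upwards [self_mem_nhdsWithin] with s hs using (hconst s hs).symm)) hlim
  rw [← hqc, hq]
  simp only [sub_add_cancel, smul_smul, mul_inv_cancel₀ (solU_pos t ω).ne', one_smul]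

/-- Otherwise `f / u` has a nonzero limit at infinity, and `u ≥ 1` keeps `‖f‖` away from zero. -/
lemma eq_neg_G_smul_of_memLp {f f' : ℝ → ℂ} {ω : ℝ} {c d : ℂ}
    (hd : ∀ t > 0, HasDerivAt f (f' t) t)
    (hw : ∀ t > 0, solU t ω • f' t - solUDeriv t ω • f t = d)
    (h0 : Tendsto f (𝓝[>] 0) (𝓝 c)) (hf : MemLp f 2 (volume.restrict (Ioi 0))) :
    c + G ω • d = 0 := by
  by_contra hne
  have hpos : 0 < ‖c + G ω • d‖ := norm_pos_iff.2 hne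
  have hlim : Tendsto (fun t => ‖c + primG ω t • d‖) atTop (𝓝 ‖c + G ω • d‖) :=
    (((tendsto_primG ω).smul_const d).const_add c).norm
  refine not_memLp_of_eventually_le (half_pos hpos) ?_ hf
  filter_upwards [hlim.eventually_const_le (half_lt_self hpos), eventually_gt_atTop 0]
    with t h1 ht
  rw [eq_of_wronskian_const hd hw h0 ht, norm_smul, Real.norm_of_nonneg (solU_pos t ω).le]
  exact h1.trans (le_mul_of_one_le_left (norm_nonneg _) (one_le_solU t ω))

/-! ### Eigenfunctions -/

lemma cos_sin_of_eigenfunction {θ ω : ℝ} {f : ℝ → ℂ} (hf : MemDomainB θ f)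
    (heq : ∀ᵐ t, formalA f t = ((-ω ^ 2 : ℝ) : ℂ) * f t) (hne : f ≠ 0) :
    G ω * Real.cos θ = -(√2 * Real.sin θ) := by
  obtain ⟨dr, dl, hdr, hdl, hb⟩ := hf.boundary
  obtain ⟨wr, hwr⟩ := wronskian_const isOpen_Ioi ordConnected_Ioi hf.right (ae_restrict_of_ae heq)
  obtain ⟨wl, hwl⟩ := wronskian_const isOpen_Iio ordConnected_Iio hf.left (ae_restrict_of_ae heq)
  -- Because `u(0) = 1` and `u'(0) = 0`, each constant Wronskian equals the one-sided derivative of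
  -- `f` at `0`.
  have hlim : ∀ {l : Filter ℝ} [l.NeBot] {d w : ℂ}, l ≤ 𝓝 0 → Tendsto (deriv f) l (𝓝 d) →
      (∀ᶠ t in l, solU t ω • deriv f t - solUDeriv t ω • f t = w) → w = d := by
    intro l _ d w hl hd hw
    have hu := ((continuous_solU ω).tendsto 0).mono_left hl
    have hu' := ((continuous_solUDeriv ω).tendsto 0).mono_left hl
    have h := (hu.smul hd).sub (hu'.smul (hf.continuousAt_zero.tendsto.mono_left hl))
    rw [solU_zero, solUDeriv_zero, one_smul, zero_smul, sub_zero] at h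
    exact tendsto_nhds_unique (tendsto_const_nhds.congr' (hw.mono fun t ht => ht.symm)) h
  obtain rfl : wr = dr := hlim nhdsWithin_le_nhds hdr
    (eventually_of_mem self_mem_nhdsWithin hwr)
  obtain rfl : wl = dl := hlim nhdsWithin_le_nhds hdl
    (eventually_of_mem self_mem_nhdsWithin hwl)
  have hRd : ∀ t > 0, HasDerivAt f (deriv f t) t := fun t ht =>
    (hf.right.differentiableOn.differentiableAt (isOpen_Ioi.mem_nhds ht)).hasDerivAt
  have hR0 : Tendsto f (𝓝[>] 0) (𝓝 (f 0)) :=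
    hf.continuousAt_zero.tendsto.mono_left nhdsWithin_le_nhds
  -- The left half line is reflected onto the right one; `u` being even, the Wronskian only changes
  -- sign.
  have hLd : ∀ t > 0, HasDerivAt (fun s => f (-s)) (-deriv f (-t)) t := fun t ht => by
    have h := (hf.left.differentiableOn.differentiableAt
      (isOpen_Iio.mem_nhds (neg_lt_zero.2 ht))).hasDerivAt
    simpa using! h.scomp t (hasDerivAt_neg t)
  have hLw : ∀ t > 0, solU t ω • -deriv f (-t) - solUDeriv t ω • f (-t) = -wl := fun t ht => by
    rw [← hwl (-t) (neg_lt_zero.2 ht), solU_neg, solUDeriv_neg]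
    simp only [smul_neg, neg_smul]
    ring
  have hneg : Tendsto (fun t : ℝ => -t) (𝓝 0) (𝓝 0) := by
    simpa using (continuous_neg (G := ℝ)).tendsto 0
  have hL0 : Tendsto (fun t => f (-t)) (𝓝[>] 0) (𝓝 (f 0)) :=
    (hf.continuousAt_zero.tendsto.comp hneg).mono_left nhdsWithin_le_nhds
  have hLp : MemLp (fun t => f (-t)) 2 (volume.restrict (Ioi 0)) :=
    (hf.memLp.comp_measurePreserving (Measure.measurePreserving_neg volume)).restrict _
  have eR := eq_neg_G_smul_of_memLp hRd hwr hR0 hf.right.memLp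
  have eL := eq_neg_G_smul_of_memLp hLd hLw hL0 hLp
  have hG : (G ω : ℂ) ≠ 0 := by exact_mod_cast (G_pos ω).ne'
  rw [Complex.real_smul] at eR eL
  -- If `f(0) = 0`, both Wronskians vanish because `G ω ≠ 0`, and the explicit formula gives `f =
  -- 0`.
  have hf0 : f 0 ≠ 0 := by
    intro h0
    have hr : wr = 0 := by simpa [h0, hG] using eR
    have hl : -wl = 0 := by simpa [h0, hG] using eL
    refine hne (funext fun t => ?_)
    rcases lt_trichotomy t 0 with ht | rfl | ht
    · have := eq_of_wronskian_const hLd hLw hL0 (neg_pos.2 ht)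
      simpa [h0, hl, hr] using this
    · exact h0
    · simpa [h0, hr] using eq_of_wronskian_const hRd hwr hR0 ht
  have h2 : ((√2 : ℝ) : ℂ) * √2 = 2 := by
    rw [← Complex.ofReal_mul, Real.mul_self_sqrt zero_le_two]
    simp
  -- Adding `eR` and `eL` gives `2 f(0) + G(ω) (wr - wl) = 0`; the extra factor `√2` on both sides
  -- matches that `2`.
  have key : ((√2 : ℝ) : ℂ) * ((G ω * Real.cos θ : ℝ) : ℂ) * f 0 =
      ((√2 : ℝ) : ℂ) * ((-(√2 * Real.sin θ) : ℝ) : ℂ) * f 0 := by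
    push_cast at hb ⊢
    linear_combination (G ω : ℂ) * hb + Complex.sin θ * eR + Complex.sin θ * eL
      + Complex.sin θ * f 0 * h2
  have hs2 : ((√2 : ℝ) : ℂ) ≠ 0 := by simp
  exact_mod_cast mul_left_cancel₀ hs2 (mul_right_cancel₀ hf0 key)

/-! ### Construction of eigenfunctions -/

/-- Here `f` agrees with the classical solution `y` only on `s`, which allows different solutions to
be glued at `0`. -/
lemma memMaxDomain_of_hasDerivAt {s : Set ℝ} (hs : IsOpen s) {f : ℝ → ℂ} {y y' : ℝ → ℝ} {ω : ℝ}
    (hy : ∀ t, HasDerivAt y (y' t) t)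
    (hy' : ∀ t, HasDerivAt y' ((t ^ 2 + 2 * ω ^ 2) * y t) t)
    (hfy : EqOn f (fun t => (y t : ℂ)) s) (hf : MemLp f 2 (volume.restrict s)) :
    MemMaxDomain s f ∧ (∀ t ∈ s, deriv f t = y' t) ∧
      ∀ t ∈ s, formalA f t = ((-ω ^ 2 : ℝ) : ℂ) * f t := by
  have hfd : ∀ t ∈ s, HasDerivAt f (y' t : ℂ) t := fun t ht =>
    (hy t).ofReal_comp.congr_of_eventuallyEq (eventually_of_mem (hs.mem_nhds ht) hfy)
  have hd : EqOn (deriv f) (fun t => (y' t : ℂ)) s := fun t ht => (hfd t ht).deriv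
  have hA : ∀ t ∈ s, formalA f t = ((-ω ^ 2 : ℝ) : ℂ) * f t := fun t ht => by
    have hdd : HasDerivAt (deriv f) (((t ^ 2 + 2 * ω ^ 2) * y t : ℝ) : ℂ) t :=
      (hy' t).ofReal_comp.congr_of_eventuallyEq (eventually_of_mem (hs.mem_nhds ht) hd)
    rw [formalA, hdd.deriv, hfy ht]
    push_cast
    ring
  have hyc : Continuous y := continuous_iff_continuousAt.2 fun t => (hy t).continuousAt
  have hyc' : Continuous y' := continuous_iff_continuousAt.2 fun t => (hy' t).continuousAt
  have hac : ∀ {g : ℝ → ℝ}, ContDiff ℝ 1 g → LocallyAC (fun t => (g t : ℂ)) s := fun hg a b _ =>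
    (Complex.ofRealCLM.contDiff.comp hg).contDiffOn.absolutelyContinuousOnInterval
  refine ⟨⟨fun t ht => (hfd t ht).differentiableAt.differentiableWithinAt,
    (hac (contDiff_one_of_hasDerivAt hy hyc')).congr hfy.symm,
    (hac (contDiff_one_of_hasDerivAt hy' (by fun_prop))).congr hd.symm, hf, ?_⟩, hd, hA⟩
  refine (hf.const_mul ((-ω ^ 2 : ℝ) : ℂ)).ae_eq ?_
  filter_upwards [ae_restrict_mem hs.measurableSet] with t ht using (hA t ht).symm

/-- The solution `u(t, ω) (G(ω) - ε ∫₀^t u(s, ω)⁻² ds)`, which decays at `+∞` for `ε = 1` and at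
`-∞` for `ε = -1`. -/
noncomputable def decaySol (ε ω t : ℝ) : ℝ := solU t ω * (G ω - ε * primG ω t)

/-- The derivative of `decaySol ε ω`. -/
noncomputable def decaySolDeriv (ε ω t : ℝ) : ℝ :=
  solUDeriv t ω * (G ω - ε * primG ω t) - ε * (solU t ω)⁻¹

lemma hasDerivAt_decaySol (ε ω t : ℝ) :
    HasDerivAt (decaySol ε ω) (decaySolDeriv ε ω t) t := by
  refine ((hasDerivAt_solU t ω).mul
    (((hasDerivAt_primG ω t).const_mul ε).const_sub (G ω))).congr_deriv ?_
  have := (solU_pos t ω).ne'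
  rw [decaySolDeriv]
  field_simp
  ring

lemma hasDerivAt_decaySolDeriv (ε ω t : ℝ) :
    HasDerivAt (decaySolDeriv ε ω) ((t ^ 2 + 2 * ω ^ 2) * decaySol ε ω t) t := by
  have hu := (solU_pos t ω).ne'
  refine (((hasDerivAt_solUDeriv t ω).mul
    (((hasDerivAt_primG ω t).const_mul ε).const_sub (G ω))).sub
    (((hasDerivAt_solU t ω).inv hu).const_mul ε)).congr_deriv ?_
  rw [decaySol]
  field_simp
  ring

lemma decaySol_neg (ε ω t : ℝ) : decaySol ε ω (-t) = decaySol (-ε) ω t := by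
  rw [decaySol, decaySol, solU_neg, primG_neg]
  ring

lemma decaySolDeriv_zero (ε ω : ℝ) : decaySolDeriv ε ω 0 = -ε := by
  simp [decaySolDeriv, solU_zero, solUDeriv_zero]

lemma continuous_decaySol (ε ω : ℝ) : Continuous (decaySol ε ω) :=
  continuous_iff_continuousAt.2 fun t => (hasDerivAt_decaySol ε ω t).continuousAt

/-- As `u` increases on `[0, ∞)`, `u(t) ∫ₜ^∞ u⁻² ≤ ∫ₜ^∞ u⁻¹`. In the bound `24 (1 + s²)⁻²` for
`u⁻¹`, one factor is replaced by its value at `t` and the other integrates to at most `π`. -/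
lemma abs_decaySol_le (ω : ℝ) {t : ℝ} (ht : 0 ≤ t) :
    |decaySol 1 ω t| ≤ 24 * Real.pi * (1 + t ^ 2)⁻¹ := by
  have hu := solU_pos t ω
  have hint : Integrable fun s : ℝ => 24 * (1 + t ^ 2)⁻¹ * (1 + s ^ 2)⁻¹ :=
    integrable_inv_one_add_sq.const_mul _
  have hnn : 0 ≤ decaySol 1 ω t := by
    rw [decaySol, one_mul, G_sub_primG ω ht]
    exact mul_nonneg hu.le (integral_nonneg fun _ => inv_nonneg.2 (sq_nonneg _))
  rw [abs_of_nonneg hnn, decaySol, one_mul, G_sub_primG ω ht, ← integral_const_mul]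
  calc ∫ s in Ioi t, solU t ω * (solU s ω ^ 2)⁻¹
      ≤ ∫ s in Ioi t, 24 * (1 + t ^ 2)⁻¹ * (1 + s ^ 2)⁻¹ := by
        refine setIntegral_mono_on ((integrable_inv_sq_solU ω).const_mul _).integrableOn
          hint.integrableOn measurableSet_Ioi fun s hs => ?_
        have hts : t ≤ s := (mem_Ioi.1 hs).le
        have hm : solU t ω ≤ solU s ω := monotoneOn_solU ω ht (ht.trans hts) hts
        have hs' := solU_pos s ω
        calc solU t ω * (solU s ω ^ 2)⁻¹ ≤ solU s ω * (solU s ω ^ 2)⁻¹ := by gcongr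
          _ = (solU s ω)⁻¹ := by field_simp
          _ ≤ 24 * ((1 + s ^ 2) ^ 2)⁻¹ := inv_solU_le s ω
          _ = 24 * (1 + s ^ 2)⁻¹ * (1 + s ^ 2)⁻¹ := by
            rw [sq (1 + s ^ 2), mul_inv]
            ring
          _ ≤ 24 * (1 + t ^ 2)⁻¹ * (1 + s ^ 2)⁻¹ := by gcongr
    _ ≤ ∫ s, 24 * (1 + t ^ 2)⁻¹ * (1 + s ^ 2)⁻¹ :=
        setIntegral_le_integral hint (ae_of_all _ fun s => by positivity)
    _ = 24 * Real.pi * (1 + t ^ 2)⁻¹ := by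
        rw [integral_const_mul, integral_univ_inv_one_add_sq]
        ring

lemma memLp_decaySol_abs (ω : ℝ) : MemLp (fun t => (decaySol 1 ω |t| : ℂ)) 2 volume := by
  have hc : Continuous fun t : ℝ => (decaySol 1 ω |t| : ℂ) :=
    Complex.continuous_ofReal.comp ((continuous_decaySol 1 ω).comp continuous_abs)
  rw [memLp_two_iff_integrable_sq_norm hc.aestronglyMeasurable]
  refine (integrable_inv_one_add_sq.const_mul ((24 * Real.pi) ^ 2)).mono'
    (hc.norm.pow 2).aestronglyMeasurable (ae_of_all _ fun t => ?_)
  have h := abs_decaySol_le ω (abs_nonneg t)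
  rw [sq_abs] at h
  rw [Real.norm_of_nonneg (by positivity), Complex.norm_real, Real.norm_eq_abs]
  have h1 : (1 + t ^ 2)⁻¹ ≤ 1 := inv_le_one_of_one_le₀ (by nlinarith [sq_nonneg t])
  have h0 : 0 ≤ (1 + t ^ 2)⁻¹ := by positivity
  calc |(decaySol 1 ω |t|)| ^ 2 ≤ (24 * Real.pi * (1 + t ^ 2)⁻¹) ^ 2 := by gcongr
    _ = (24 * Real.pi) ^ 2 * ((1 + t ^ 2)⁻¹ * (1 + t ^ 2)⁻¹) := by ring
    _ ≤ (24 * Real.pi) ^ 2 * (1 + t ^ 2)⁻¹ := by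
      gcongr
      exact mul_le_of_le_one_left h0 h1

lemma exists_eigenfunction {θ ω : ℝ} (h : G ω * Real.cos θ = -(√2 * Real.sin θ)) :
    ∃ f : ℝ → ℂ, MemDomainB θ f ∧ (∀ᵐ t, formalA f t = ((-ω ^ 2 : ℝ) : ℂ) * f t) ∧ f ≠ 0 := by
  -- The even extension coincides with `decaySol (-1) ω` on the left; its one-sided derivatives at
  -- `0` are `-1` and `1`, and its value there is `G ω`.
  set f : ℝ → ℂ := fun t => (decaySol 1 ω |t| : ℂ) with hf
  have hLp : MemLp f 2 volume := memLp_decaySol_abs ω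
  have hf0 : f 0 = G ω := by simp [hf, decaySol, solU_zero, primG_zero]
  have hc : Continuous f :=
    Complex.continuous_ofReal.comp ((continuous_decaySol 1 ω).comp continuous_abs)
  obtain ⟨mr, dr, ar⟩ := memMaxDomain_of_hasDerivAt (f := f) (y := decaySol 1 ω) isOpen_Ioi
    (hasDerivAt_decaySol 1 ω) (hasDerivAt_decaySolDeriv 1 ω)
    (fun t (ht : 0 < t) => by simp only [hf, abs_of_pos ht]) (hLp.restrict (Ioi 0))
  obtain ⟨ml, dl, al⟩ := memMaxDomain_of_hasDerivAt (f := f) (y := decaySol (-1) ω) isOpen_Iio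
    (hasDerivAt_decaySol (-1) ω) (hasDerivAt_decaySolDeriv (-1) ω)
    (fun t (ht : t < 0) => by simp only [hf, abs_of_neg ht, decaySol_neg]) (hLp.restrict (Iio 0))
  have hlim : ∀ (ε : ℝ) (l : Filter ℝ), l ≤ 𝓝 0 →
      Tendsto (fun t => (decaySolDeriv ε ω t : ℂ)) l (𝓝 ((-ε : ℝ) : ℂ)) := fun ε l hl => by
    have := (hasDerivAt_decaySolDeriv ε ω 0).continuousAt.tendsto.mono_left hl
    rw [decaySolDeriv_zero] at this
    exact (Complex.continuous_ofReal.tendsto _).comp this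
  refine ⟨f, ⟨mr, ml, hc.continuousAt, ((-1 : ℝ) : ℂ), ((-(-1) : ℝ) : ℂ), ?_, ?_, ?_⟩,
    ae_of_ae_halfLines ?_ ?_, fun h0 => ?_⟩
  · refine (hlim 1 _ nhdsWithin_le_nhds).congr' ?_
    filter_upwards [self_mem_nhdsWithin] with t ht using (dr t ht).symm
  · refine (hlim (-1) _ nhdsWithin_le_nhds).congr' ?_
    filter_upwards [self_mem_nhdsWithin] with t ht using (dl t ht).symm
  · rw [hf0, ← Complex.ofReal_mul, ← Complex.ofReal_sub, ← Complex.ofReal_mul,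
      Complex.ofReal_inj]
    have h2 : √2 * √2 = 2 := Real.mul_self_sqrt zero_le_two
    linear_combination √2 * h - Real.sin θ * h2
  · filter_upwards [ae_restrict_mem measurableSet_Ioi] with t ht using ar t ht
  · filter_upwards [ae_restrict_mem measurableSet_Iio] with t ht using al t ht
  · have : (G ω : ℂ) = 0 := by rw [← hf0, h0, Pi.zero_apply]
    exact (G_pos ω).ne' (by exact_mod_cast this)

/-! ### Eigenvalues and the angle equation -/

/-- Passes between `L²` classes and functions; continuity of functions in the domain makes a nonzero
function represent a nonzero class. -/
lemma isEigenvalue_opB_iff_exists {θ : ℝ} {μ : ℂ} :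
    IsEigenvalue (opB θ) μ ↔
      ∃ f : ℝ → ℂ, MemDomainB θ f ∧ (∀ᵐ t, formalA f t = μ * f t) ∧ f ≠ 0 := by
  constructor
  · rintro ⟨x, hx, hT⟩
    have hr := coe_ae_eq_rep θ x
    refine ⟨rep θ x, rep_mem θ x, ?_, fun h0 => hx ?_⟩
    · have h1 := opB_ae_eq (rep_mem θ x) x hr
      rw [hT] at h1
      filter_upwards [h1, Lp.coeFn_smul μ (x : Lp ℂ 2 (volume : Measure ℝ)), hr] with t h1 h2 h3
      rw [← h1, h2, Pi.smul_apply, smul_eq_mul, h3]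
    · rw [h0] at hr
      exact (Lp.eq_zero_iff_ae_eq_zero).2 hr
  · rintro ⟨f, hf, heq, hne⟩
    have hF := hf.memLp.coeFn_toLp
    refine ⟨⟨hf.memLp.toLp f, f, hf, hF⟩, fun h0 => hne ?_, ?_⟩
    · have hz : f =ᵐ[volume] (fun _ => (0 : ℂ)) := by
        filter_upwards [hF, (Lp.eq_zero_iff_ae_eq_zero).1 h0] with t h1 h2
        exact h1.symm.trans h2
      exact (hf.continuous.ae_eq_iff_eq _ continuous_const).1 hz
    · refine Lp.ext ?_
      filter_upwards [opB_ae_eq hf ⟨hf.memLp.toLp f, f, hf, hF⟩ hF,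
        Lp.coeFn_smul μ (hf.memLp.toLp f), hF, heq] with t h1 h2 h3 h4
      rw [h1, h2, Pi.smul_apply, h3, h4, smul_eq_mul]

/-- The number `-ω²` is an eigenvalue of `B_θ` if and only if `θ = π - arctan (G(ω) / √2)`. -/
lemma isEigenvalue_opB_iff {θ : ℝ} (hθ : θ ∈ Ico 0 Real.pi) (ω : ℝ) :
    IsEigenvalue (opB θ) ((-ω ^ 2 : ℝ) : ℂ) ↔ θ = Real.pi - Real.arctan (G ω / √2) := by
  have hG := G_pos ω
  have hs2 : 0 < √2 := by positivity
  have h1 : IsEigenvalue (opB θ) ((-ω ^ 2 : ℝ) : ℂ) ↔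
      G ω * Real.cos θ = -(√2 * Real.sin θ) :=
    isEigenvalue_opB_iff_exists.trans
      ⟨fun ⟨f, hf, he, hn⟩ => cos_sin_of_eigenfunction hf he hn, exists_eigenfunction⟩
  rw [h1]
  constructor
  · intro h
    -- On `[0, π)` the sine is nonnegative, so the equation forces a negative cosine. Thus `π - θ`
    -- lies in `(0, π / 2)`, where `arctan` inverts `tan`; `θ = 0` would give `G ω = 0`.
    have hsin : 0 ≤ Real.sin θ := Real.sin_nonneg_of_nonneg_of_le_pi hθ.1 hθ.2.le
    have hcos : Real.cos θ < 0 := by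
      rcases hθ.1.eq_or_lt with rfl | hpos
      · simp [hG.ne'] at h
      · have := Real.sin_pos_of_pos_of_lt_pi hpos hθ.2
        have h3 : 0 < √2 * Real.sin θ := by positivity
        by_contra! h4
        have := mul_nonneg hG.le h4
        linarith
    have hgt : Real.pi / 2 < θ := by
      by_contra! hle
      exact hcos.not_ge
        (Real.cos_nonneg_of_neg_pi_div_two_le_of_le (by linarith [hθ.1, Real.pi_pos]) hle)
    have e : G ω / √2 = Real.tan (Real.pi - θ) := by
      rw [Real.tan_pi_sub, Real.tan_eq_sin_div_cos, ← neg_div, div_eq_div_iff hs2.ne' hcos.ne, h]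
      ring
    rw [e, Real.arctan_tan (by linarith [hθ.2, Real.pi_pos]) (by linarith)]
    ring
  · rintro rfl
    rw [Real.cos_pi_sub, Real.sin_pi_sub]
    have hc := Real.cos_arctan_pos (G ω / √2)
    have ht := Real.tan_arctan (G ω / √2)
    rw [Real.tan_eq_sin_div_cos, div_eq_div_iff hc.ne' hs2.ne'] at ht
    linarith

end SingularOscillator

namespace SingularOscillator

/-! ### The angle `π - arctan (G(ω) / √2)` -/

/-- The angle `θ` for which `-ω²` is an eigenvalue of `B_θ`. -/
noncomputable def angle (ω : ℝ) : ℝ := Real.pi - Real.arctan (G ω / √2)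

lemma angle_zero : angle 0 = Real.pi - alphaB := rfl

lemma angle_strictMonoOn : StrictMonoOn angle (Ici 0) := fun a ha b hb hab => by
  have := G_strictAntiOn ha hb hab
  have h2 : 0 < √2 := by positivity
  rw [angle, angle]
  have := Real.arctan_strictMono ((div_lt_div_iff_of_pos_right h2).2 this)
  linarith

lemma continuous_angle : Continuous angle :=
  continuous_const.sub (Real.continuous_arctan.comp (continuous_G.div_const _))

lemma angle_lt_pi (ω : ℝ) : angle ω < Real.pi := by
  have : 0 < Real.arctan (G ω / √2) :=
    Real.arctan_pos.2 (div_pos (G_pos ω) (by positivity))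
  rw [angle]
  linarith

lemma tendsto_angle : Tendsto angle atTop (𝓝 Real.pi) := by
  have h := ((Real.continuous_arctan.tendsto (0 / √2)).comp
    (tendsto_G.div_const √2)).const_sub Real.pi
  rwa [zero_div, Real.arctan_zero, sub_zero] at h

lemma angle_pos (ω : ℝ) : 0 < angle ω := by
  have := Real.arctan_lt_pi_div_two (G ω / √2)
  have := Real.pi_pos
  rw [angle]
  linarith

lemma exists_angle_eq {θ : ℝ} (hθ : θ ∈ Ioo (angle 0) Real.pi) : ∃ ω > 0, angle ω = θ := by
  obtain ⟨R, hR, hR0⟩ :=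
    ((tendsto_angle.eventually_const_lt hθ.2).and (eventually_gt_atTop 0)).exists
  obtain ⟨ω, hω, e⟩ := intermediate_value_Ioo hR0.le continuous_angle.continuousOn ⟨hθ.1, hR⟩
  exact ⟨ω, hω.1, e⟩

lemma isEigenvalue_opB_iff_angle {θ μ : ℝ} (hθ : θ ∈ Ico 0 Real.pi) (hμ : μ ≤ 0) :
    IsEigenvalue (opB θ) (μ : ℂ) ↔ angle √(-μ) = θ := by
  have h := isEigenvalue_opB_iff hθ √(-μ)
  rw [Real.sq_sqrt (by linarith), neg_neg] at h
  rw [h, eq_comm, angle]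

end SingularOscillator

/-! ### The four claims -/

open SingularOscillator in

theorem lemma3p4 :
    -- the integrals defining `G(ω)` converge
    (∀ ω : ℝ, 0 ≤ ω →
      MeasureTheory.IntegrableOn (fun s => (SingularOscillator.solU s ω ^ 2)⁻¹) (Set.Ioi 0)) ∧
    (∀ θ ∈ Set.Ico 0 Real.pi,
      (SingularOscillator.IsEigenvalue (SingularOscillator.opB θ) 0 ↔
        θ = Real.pi - SingularOscillator.alphaB)) ∧
    (∀ θ ∈ Set.Ico 0 Real.pi,
      ((∃ μ : ℝ, μ < 0 ∧ SingularOscillator.IsEigenvalue (SingularOscillator.opB θ) (μ : ℂ)) ↔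
        θ ∈ Set.Ioo (Real.pi - SingularOscillator.alphaB) Real.pi)) ∧
    (∀ θ₁ ∈ Set.Ico 0 Real.pi, ∀ θ₂ ∈ Set.Ico 0 Real.pi, ∀ μ₁ μ₂ : ℝ,
      SingularOscillator.IsEigenvalue (SingularOscillator.opB θ₁) (μ₁ : ℂ) →
      SingularOscillator.IsEigenvalue (SingularOscillator.opB θ₂) (μ₂ : ℂ) →
      μ₂ < μ₁ → μ₁ < 0 →
      Real.pi - SingularOscillator.alphaB < θ₁ ∧ θ₁ < θ₂ ∧ θ₂ < Real.pi) ∧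
    -- for `θ ∈ (π - α_B, π)` there is exactly one negative eigenvalue `Λ θ`; it is strictly
    -- decreasing in `θ` and tends to `-∞` as `θ → π`
    (∃ Λ : ℝ → ℝ,
      (∀ θ ∈ Set.Ioo (Real.pi - SingularOscillator.alphaB) Real.pi, ∀ μ : ℝ,
        (μ < 0 ∧ SingularOscillator.IsEigenvalue (SingularOscillator.opB θ) (μ : ℂ)) ↔ μ = Λ θ) ∧
      StrictAntiOn Λ (Set.Ioo (Real.pi - SingularOscillator.alphaB) Real.pi) ∧
      Filter.Tendsto Λ (nhdsWithin Real.pi (Set.Iio Real.pi)) Filter.atBot) := by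

  have hpos : ∀ {μ : ℝ}, μ < 0 → 0 < √(-μ) := fun h => Real.sqrt_pos.2 (neg_pos.2 h)
  have hIco : ∀ {θ : ℝ}, θ ∈ Ioo (Real.pi - alphaB) Real.pi → θ ∈ Ico 0 Real.pi := fun h =>
    ⟨(angle_pos 0).le.trans h.1.le, h.2⟩
  -- `Ω` will be the inverse of `angle` on the interval, unconstrained elsewhere; the eigenvalue is
  -- then `-Ω(θ)²`.
  have hex : ∀ θ : ℝ, ∃ ω : ℝ, θ ∈ Ioo (Real.pi - alphaB) Real.pi → 0 < ω ∧ angle ω = θ := by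
    intro θ
    by_cases hθ : θ ∈ Ioo (Real.pi - alphaB) Real.pi
    · obtain ⟨ω, h⟩ := exists_angle_eq hθ
      exact ⟨ω, fun _ => h⟩
    · exact ⟨0, fun h => absurd h hθ⟩
  choose Ω hΩ using hex
  have hΩmono : StrictMonoOn Ω (Ioo (Real.pi - alphaB) Real.pi) := fun a ha b hb hab => by
    obtain ⟨pa, ea⟩ := hΩ a ha
    obtain ⟨pb, eb⟩ := hΩ b hb
    rw [← ea, ← eb] at hab
    exact (angle_strictMonoOn.lt_iff_lt pa.le pb.le).1 hab
  refine ⟨fun ω _ => (integrable_inv_sq_solU ω).integrableOn, fun θ hθ => ?_, fun θ hθ => ?_,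
    fun θ₁ h₁ θ₂ h₂ μ₁ μ₂ e₁ e₂ hlt hneg => ?_, fun θ => -Ω θ ^ 2, fun θ hθ μ => ?_, ?_, ?_⟩
  · have h := isEigenvalue_opB_iff_angle hθ (le_refl 0)
    rw [neg_zero, Real.sqrt_zero, angle_zero, Complex.ofReal_zero] at h
    exact h.trans eq_comm
  · constructor
    · rintro ⟨μ, hμ, h⟩
      rw [isEigenvalue_opB_iff_angle hθ hμ.le] at h
      rw [← h]
      exact ⟨angle_strictMonoOn self_mem_Ici (hpos hμ).le (hpos hμ), angle_lt_pi _⟩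
    · intro h
      obtain ⟨hp, he⟩ := hΩ θ h
      have hn : -Ω θ ^ 2 < 0 := neg_lt_zero.2 (by positivity)
      refine ⟨-Ω θ ^ 2, hn, ?_⟩
      rw [isEigenvalue_opB_iff_angle hθ hn.le, neg_neg, Real.sqrt_sq hp.le, he]
  · rw [isEigenvalue_opB_iff_angle h₁ hneg.le] at e₁
    rw [isEigenvalue_opB_iff_angle h₂ (hlt.trans hneg).le] at e₂
    rw [← e₁, ← e₂]
    exact ⟨angle_strictMonoOn self_mem_Ici (hpos hneg).le (hpos hneg),
      angle_strictMonoOn (hpos hneg).le (hpos (hlt.trans hneg)).le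
        (Real.sqrt_lt_sqrt (by linarith) (by linarith)), angle_lt_pi _⟩
  · obtain ⟨hp, he⟩ := hΩ θ hθ
    constructor
    · rintro ⟨hμ, h⟩
      rw [isEigenvalue_opB_iff_angle (hIco hθ) hμ.le, ← he] at h
      have := angle_strictMonoOn.injOn (hpos hμ).le hp.le h
      simp only [← this, Real.sq_sqrt (neg_pos.2 hμ).le, neg_neg]
    · rintro rfl
      have hn : -Ω θ ^ 2 < 0 := neg_lt_zero.2 (by positivity)
      refine ⟨hn, ?_⟩
      rw [isEigenvalue_opB_iff_angle (hIco hθ) hn.le, neg_neg, Real.sqrt_sq hp.le, he]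
  · intro a ha b hb hab
    have h0 := (hΩ a ha).1
    have := hΩmono ha hb hab
    show -Ω b ^ 2 < -Ω a ^ 2
    gcongr
  · have hΩlim : Tendsto Ω (𝓝[<] Real.pi) atTop := by
      refine tendsto_atTop.2 fun M => ?_
      -- The absolute value puts `M` in the range where `angle` is monotone; the left end is closed
      -- because `|M|` may be `0`. Every `θ` between `angle |M|` and `π` has `Ω θ > |M|`.
      have hM : angle |M| ∈ Ico (Real.pi - alphaB) Real.pi :=
        ⟨angle_strictMonoOn.monotoneOn self_mem_Ici (abs_nonneg M) (abs_nonneg M), angle_lt_pi _⟩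
      filter_upwards [Ioo_mem_nhdsLT hM.2] with θ hθ
      obtain ⟨hp, he⟩ := hΩ θ ⟨hM.1.trans_lt hθ.1, hθ.2⟩
      rw [← he] at hθ
      exact (le_abs_self M).trans
        ((angle_strictMonoOn.lt_iff_lt (abs_nonneg M) hp.le).1 hθ.1).le
    exact tendsto_neg_atTop_atBot.comp ((tendsto_pow_atTop two_ne_zero).comp hΩlim)
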